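/- Let $G=(V,E)$ be a finite map on a closed connected oriented surface, i.e. a finite graph (loops and multiple edges allowed) embedded so that all faces are open disks, with a fixed arbitrary reference orientation of its edges. A *flow* is an element of $\mathbb{Z}^E$. A set $T$ of edges with directions of traversal has the *characteristic flow* $\phi(T)\in\mathbb{Z}^E$, where $\phi(T)_e$ is the number of forward traversals minus the number of backward traversals of $e$; the same formula defines $\phi(W)$ for a walk $W$. Let $\mathcal F$ be the set of counterclockwise facial walks, one per face (keeping the face on the left), and let $\mathbb F\le\mathbb Z^E$ be the subgroup generated by $\{\phi(F) : F\in\mathcal F\}$. Two flows are *homologous* if their difference lies in $\mathbb F$; an oriented subgraph $T$ is *$0$-homologous* if $\phi(T)\in\mathbb F$. Let $D_0$ be an orientation of $G$, let $f_0$ be a face with counterclockwise facial walk $F_0$, and put $\mathcal F'=\mathcal F\setminus\{F_0\}$. Let $O(G,D_0)$ be the set of orientations $D$ of $G$ that are homologous to $D_0$, i.e. $\phi(D)-\phi(D_0)\in\mathbb F$. A $0$-homologous oriented subgraph $T$ is *counterclockwise* (resp. *clockwise*) if $\phi(T)=\sum_{F\in\mathcal F'}\lambda_F\,\phi(F)$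 with all $\lambda_F\in\mathbb N=\{0,1,2,\dots\}$ (resp. all $-\lambda_F\in\mathbb N$). For orientations $D,D'$ let $D\setminus D'$ be the subgraph of $D$ formed by the edges that are not oriented as in $D'$, and write $D\le_{f_0}D'$ if $D\setminus D'$ is $0$-homologous and counterclockwise. **Proposition.** $(O(G,D_0),\le_{f_0})$ has a unique greatest element $D_{\max}$ and a unique least element $D_{\min}$. Every maximal element of $O(G,D_0)$ (that is, $D_{\max}$) contains no non-empty counterclockwise $0$-homologous oriented subgraph, and every minimal element (that is, $D_{\min}$) contains no non-empty clockwise $0$-homologous oriented subgraph. Here an oriented subgraph is a set of directed edges, and it is non-empty if it has at least one edge. -/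

import Mathlib

/-- A dart: an edge together with a direction of traversal. For the fixed reference orientation of
the edges, `(e, true)` traverses `e` forward and `(e, false)` traverses `e` backward. -/
abbrev Dart (E : Type*) := E × Bool

/-- The same edge traversed in the opposite direction. -/
def Dart.rev {E : Type*} : Equiv.Perm (Dart E) where
  toFun d := (d.1, !d.2)
  invFun d := (d.1, !d.2)
  left_inv d := by simp
  right_inv d := by simp

/-- A map on a closed connected oriented surface, given as a combinatorial map (rotation system),
together with a fixed reference orientation of its edges. Loops and multiple edges are allowed,
contractible or not. `V`, `E`, `F` are the vertices, edges and faces.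

The darts starting at a vertex are permuted cyclically by `rot`, which sends a dart to the next one
in counterclockwise order around the vertex. The walk that keeps a face on its left continues,
after the dart `d`, with the dart that follows `rev d` in clockwise order around the end vertex
of `d`, that is with `rot⁻¹ (rev d)`; the orbits of this permutation are the
counterclockwise facial walks. -/
structure SurfaceMap (V E F : Type*) where
  /-- The next dart in counterclockwise order around the starting vertex. -/
  rot : Equiv.Perm (Dart E)
  /-- The starting vertex of a dart. -/
  origin : Dart E → V
  /-- The face on the left of a dart. -/
  left : Dart E → F
  /-- The vertices correspond to the cycles of the rotation. -/
  origin_eq_iff : ∀ d d', origin d = origin d' ↔ rot.SameCycle d d'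
  /-- The faces correspond to the cycles of the facial permutation. -/
  left_eq_iff : ∀ d d', left d = left d' ↔ (rot⁻¹ * Dart.rev).SameCycle d d'
  nonempty_vertex : Nonempty V
  /-- The graph is connected: any two vertices are joined by a walk. -/
  connected : ∀ u v : V,
    Relation.ReflTransGen (fun x y => ∃ d, origin d = x ∧ origin (Dart.rev d) = y) u v
  /-- If there are edges, then every face is incident to an edge. -/
  left_surjective : Nonempty E → Function.Surjective left
  /-- The map without edges (one vertex on the sphere) has exactly one face. -/
  card_face_of_isEmpty : IsEmpty E → Nat.card F = 1

/-- The characteristic flow in `ℤ^E` of a set of darts (walks of unit length): at the edge `e` it is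
the number of forward traversals minus the number of backward traversals. -/
noncomputable def charFlow {E : Type*} (T : Set (Dart E)) : E → ℤ :=
  fun e => T.indicator 1 (e, true) - T.indicator 1 (e, false)

/-- An orientation of the graph: a direction for every edge (`true` if it is the direction of the
reference orientation). -/
abbrev EdgeOrientation (E : Type*) := E → Bool

/-- The set of directed edges of an orientation. -/
def arcs {E : Type*} (D : EdgeOrientation E) : Set (Dart E) := {d | d.2 = D d.1}

/-- `D ∖ D'`: the edges of `D`, with their direction in `D`, that are not oriented as in `D'`. -/
def orientationDiff {E : Type*} (D D' : EdgeOrientation E) : Set (Dart E) := arcs D \ arcs D'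

namespace SurfaceMap

variable {V E F : Type*} (M : SurfaceMap V E F)

/-- The characteristic flow of the counterclockwise facial walk around the face `f`: this walk
traverses every dart having `f` on its left exactly once. -/
noncomputable def facialFlow (f : F) : E → ℤ := charFlow {d | M.left d = f}

/-- The subgroup of `ℤ^E` generated by the counterclockwise facial walks. -/
def facialSubgroup : AddSubgroup (E → ℤ) := AddSubgroup.closure (Set.range M.facialFlow)

/-- Two flows are homologous if their difference is generated by facial walks. -/
def Homologous (x y : E → ℤ) : Prop := x - y ∈ M.facialSubgroup

/-- An oriented subgraph is `0`-homologous if its characteristic flow is homologous to zero. -/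
def ZeroHomologous (T : Set (Dart E)) : Prop := M.Homologous (charFlow T) 0

open Classical in
/-- The characteristic flow is a combination, with coefficients in `ℕ`, of the counterclockwise
facial walks other than the one of `f₀`. -/
def IsCounterclockwise [Fintype F] (f₀ : F) (T : Set (Dart E)) : Prop :=
  ∃ c : F → ℕ, charFlow T = ∑ f ∈ Finset.univ.erase f₀, (c f : ℤ) • M.facialFlow f

open Classical in
/-- The characteristic flow is a combination, with coefficients in `-ℕ`, of the counterclockwise
facial walks other than the one of `f₀`. -/
def IsClockwise [Fintype F] (f₀ : F) (T : Set (Dart E)) : Prop :=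
  ∃ c : F → ℕ, charFlow T = ∑ f ∈ Finset.univ.erase f₀, (-(c f : ℤ)) • M.facialFlow f

/-- `O(G, D₀)`: the orientations that are homologous to `D₀`. The face `f₀` only serves to
determine the order relation on this type. -/
def HomologyClass (D₀ : EdgeOrientation E) (_f₀ : F) : Type _ :=
  {D : EdgeOrientation E // M.Homologous (charFlow (arcs D)) (charFlow (arcs D₀))}

/-- `D ≤ D'` if and only if `D ∖ D'` is counterclockwise with respect to `f₀`. -/
instance [Fintype F] (D₀ : EdgeOrientation E) (f₀ : F) : LE (M.HomologyClass D₀ f₀) where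
  le D D' := M.ZeroHomologous (orientationDiff D.1 D'.1) ∧
    M.IsCounterclockwise f₀ (orientationDiff D.1 D'.1)

end SurfaceMap

/-! Facial combinations are exactly the coboundaries of integer functions on the faces. The dual
graph is connected, so such a function is determined by its coboundary once its value at `f₀` is
fixed. Connectivity also excludes 2-torsion modulo homology, so each `D` in the class has a unique
potential `p` with `p f₀ = 0` and flow equal to that of `D₀` plus twice the coboundary of `p`.

In these terms the order is the reversed pointwise order of potentials (`le_iff_potential_le`). The
admissible potentials are cut out by bounds on differences across edges, hence are closed under
pointwise minimum and maximum; finiteness then gives both extremes. Reversing a counterclockwise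
(clockwise) subgraph moves strictly up (down), which is impossible at a maximal (minimal) element.
-/

theorem charFlow_arcs_apply {E : Type*} (D : EdgeOrientation E) (e : E) :
    charFlow (arcs D) e = if D e then 1 else -1 := by
  cases h : D e <;> simp [charFlow, arcs, Set.indicator, h]

theorem charFlow_arcs_injective {E : Type*} :
    Function.Injective fun D : EdgeOrientation E => charFlow (arcs D) := by
  intro D D' h
  funext e
  have he : charFlow (arcs D) e = charFlow (arcs D') e := congrFun h e
  rw [charFlow_arcs_apply, charFlow_arcs_apply] at he
  cases hD : D e <;> cases hD' : D' e <;> simp [hD, hD'] at he ⊢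

theorem two_smul_charFlow_orientationDiff {E : Type*} (D D' : EdgeOrientation E) :
    2 • charFlow (orientationDiff D D') = charFlow (arcs D) - charFlow (arcs D') := by
  funext e
  simp only [Pi.sub_apply, charFlow_arcs_apply, Pi.smul_apply]
  cases hD : D e <;> cases hD' : D' e <;>
    simp [charFlow, orientationDiff, arcs, Set.indicator, hD, hD']

open Classical in
/-- The orientation obtained from `D` by reversing the edges that have a dart in `T`. -/
noncomputable def reverseOn {E : Type*} (D : EdgeOrientation E) (T : Set (Dart E)) :
    EdgeOrientation E :=
  fun e => if (e, D e) ∈ T then !D e else D e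

theorem orientationDiff_reverseOn {E : Type*} {D : EdgeOrientation E} {T : Set (Dart E)}
    (hT : T ⊆ arcs D) : orientationDiff D (reverseOn D T) = T := by
  ext ⟨e, b⟩
  constructor
  · rintro ⟨hb, hn⟩
    simp only [arcs, Set.mem_ofPred_eq, reverseOn] at hb hn
    subst hb
    by_contra h
    simp [h] at hn
  · intro h
    have hb : b = D e := hT h
    subst hb
    simp [orientationDiff, arcs, reverseOn, h]

/-- A flow with values in `{1, -1}` is the characteristic flow of an orientation. -/
theorem exists_charFlow_arcs_eq {E : Type*} {x : E → ℤ} (hx : ∀ e, x e = 1 ∨ x e = -1) :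
    ∃ D : EdgeOrientation E, charFlow (arcs D) = x := by
  refine ⟨fun e => decide (x e = 1), funext fun e => ?_⟩
  rw [charFlow_arcs_apply]
  rcases hx e with h | h <;> simp [h]

/-! ### Coboundaries and connectivity of the dual graph. -/

namespace SurfaceMap

variable {V E F : Type*} (M : SurfaceMap V E F)

/-- The flow crossing each edge with the difference of the values on its two sides. -/
def coboundary : (F → ℤ) →+ (E → ℤ) where
  toFun c e := c (M.left (e, true)) - c (M.left (e, false))
  map_zero' := by funext e; simp
  map_add' a b := by funext e; simp only [Pi.add_apply]; ring

theorem coboundary_apply (c : F → ℤ) (e : E) :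
    M.coboundary c e = c (M.left (e, true)) - c (M.left (e, false)) := rfl

theorem sum_smul_facialFlow [Fintype F] (c : F → ℤ) :
    ∑ f, c f • M.facialFlow f = M.coboundary c := by
  classical
  funext e
  simp [facialFlow, charFlow, coboundary_apply, Set.indicator, mul_sub, Finset.sum_sub_distrib]

theorem facialSubgroup_eq_range [Fintype F] : M.facialSubgroup = M.coboundary.range := by
  classical
  apply le_antisymm
  · rw [facialSubgroup, AddSubgroup.closure_le]
    rintro _ ⟨f, rfl⟩
    refine ⟨Pi.single f 1, ?_⟩
    rw [← sum_smul_facialFlow]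
    simp [Pi.single_apply]
  · rintro _ ⟨c, rfl⟩
    rw [← sum_smul_facialFlow]
    exact sum_mem fun f _ =>
      zsmul_mem (AddSubgroup.subset_closure (Set.mem_range_self f)) _

/-- The facial permutation sends `rev (rot d)` to `d`. Hence one turn of the rotation crosses just
one edge. -/
theorem left_rev_rot (d : Dart E) : M.left (Dart.rev (M.rot d)) = M.left d := by
  rw [M.left_eq_iff]
  refine ⟨1, ?_⟩
  simp [Dart.rev]

/-- The dual graph is connected: a function on the faces that agrees on both sides of every edge
is constant. -/
theorem eq_of_left_eq {α : Type*} {c : F → α}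
    (hc : ∀ e, c (M.left (e, true)) = c (M.left (e, false))) (f g : F) : c f = c g := by
  have hrev : ∀ d, c (M.left (Dart.rev d)) = c (M.left d) := by
    rintro ⟨e, _ | _⟩
    · exact hc e
    · exact (hc e).symm
  have hrot : ∀ d, c (M.left (M.rot d)) = c (M.left d) := fun d => by
    rw [← hrev, left_rev_rot]
  have horigin : ∀ d d', M.origin d = M.origin d' → c (M.left d) = c (M.left d') := by
    intro d d' h
    obtain ⟨n, hn⟩ := (M.origin_eq_iff d d').1 h
    have key : ∀ n : ℤ, c (M.left ((M.rot ^ n) d)) = c (M.left d) := by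
      intro n
      induction n with
      | zero => simp
      | succ n ih => rw [add_comm, zpow_add, zpow_one, Equiv.Perm.mul_apply, hrot, ih]
      | pred n ih =>
        rw [← hrot, ← Equiv.Perm.mul_apply, ← zpow_one_add]
        simpa using ih
    rw [← hn, key]
  -- The value is constant around each vertex and unchanged by `rev`, so it propagates along walks.
  have hdart : ∀ d d', c (M.left d) = c (M.left d') := by
    intro d d'
    have key : ∀ v, Relation.ReflTransGen
        (fun x y => ∃ a, M.origin a = x ∧ M.origin (Dart.rev a) = y) (M.origin d) v →
        ∀ a, M.origin a = v → c (M.left d) = c (M.left a) := by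
      intro v h
      induction h with
      | refl => exact fun a ha => horigin _ _ ha.symm
      | tail _ hstep ih =>
        obtain ⟨b, hb, hb'⟩ := hstep
        intro a ha
        rw [ih b hb, ← hrev b]
        exact horigin _ _ (hb'.trans ha.symm)
    exact key _ (M.connected _ _) d' rfl
  rcases isEmpty_or_nonempty E with hE | hE
  · have := (Nat.card_eq_one_iff_unique.1 (M.card_face_of_isEmpty hE)).1
    rw [Subsingleton.elim f g]
  · obtain ⟨d, rfl⟩ := M.left_surjective hE f
    obtain ⟨d', rfl⟩ := M.left_surjective hE g
    exact hdart d d'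

theorem eq_of_coboundary_eq {a b : F → ℤ} {f₀ : F} (h₀ : a f₀ = b f₀)
    (h : M.coboundary a = M.coboundary b) : a = b := by
  funext f
  have := M.eq_of_left_eq (c := fun f => a f - b f) (fun e => by
    have := congrFun h e
    simp only [coboundary_apply] at this
    linarith) f f₀
  linarith

theorem exists_coboundary_eq_of_mem [Fintype F] (f₀ : F) {x : E → ℤ}
    (hx : x ∈ M.facialSubgroup) : ∃ c : F → ℤ, c f₀ = 0 ∧ M.coboundary c = x := by
  rw [facialSubgroup_eq_range] at hx
  obtain ⟨c, rfl⟩ := hx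
  refine ⟨fun f => c f - c f₀, sub_self _, funext fun e => ?_⟩
  simp only [coboundary_apply]
  ring

/-- The group of flows modulo homology has no `2`-torsion. -/
theorem mem_facialSubgroup_of_two_smul [Fintype F] {x : E → ℤ} (f₀ : F)
    (hx : 2 • x ∈ M.facialSubgroup) : x ∈ M.facialSubgroup := by
  obtain ⟨c, hc₀, hc⟩ := M.exists_coboundary_eq_of_mem f₀ hx
  have hce : ∀ e, c (M.left (e, true)) - c (M.left (e, false)) = 2 * x e := fun e => by
    have := congrFun hc e
    simpa [coboundary_apply] using this
  -- All jumps of `c` across edges are even, so its parity is constant, and it is even at `f₀`.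
  have hpar : ∀ f, c f % 2 = 0 := fun f => by
    have := M.eq_of_left_eq (c := fun f => c f % 2) (fun e => by
      have := hce e
      omega) f f₀
    simpa [hc₀] using this
  rw [facialSubgroup_eq_range]
  refine ⟨fun f => c f / 2, funext fun e => ?_⟩
  have h1 := hpar (M.left (e, true))
  have h2 := hpar (M.left (e, false))
  have h3 := hce e
  rw [coboundary_apply]
  omega

/-- Omitting `f₀` from the sum amounts to coefficient 0 there, the normalisation that makes
coefficients unique. -/
theorem isCounterclockwise_iff [Fintype F] {f₀ : F} {T : Set (Dart E)} :
    M.IsCounterclockwise f₀ T ↔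
      ∃ c : F → ℤ, 0 ≤ c ∧ c f₀ = 0 ∧ charFlow T = M.coboundary c := by
  classical
  constructor
  · rintro ⟨c, hc⟩
    refine ⟨fun f => if f = f₀ then 0 else c f, fun f => ?_, if_pos rfl, ?_⟩
    · dsimp only
      split_ifs <;> simp
    · rw [hc, ← sum_smul_facialFlow, ← Finset.add_sum_erase _ _ (Finset.mem_univ f₀), if_pos rfl,
        zero_smul, zero_add]
      refine Finset.sum_congr (by congr) fun f hf => ?_
      rw [if_neg (Finset.ne_of_mem_erase hf)]
  · rintro ⟨c, hc, hc₀, h⟩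
    refine ⟨fun f => (c f).toNat, ?_⟩
    rw [h, ← sum_smul_facialFlow, ← Finset.add_sum_erase _ _ (Finset.mem_univ f₀), hc₀,
      zero_smul, zero_add]
    refine Finset.sum_congr (by congr) fun f _ => ?_
    rw [Int.toNat_of_nonneg (hc f)]

theorem IsClockwise.exists_coboundary [Fintype F] {f₀ : F} {T : Set (Dart E)}
    (hT : M.IsClockwise f₀ T) :
    ∃ c : F → ℤ, c ≤ 0 ∧ c f₀ = 0 ∧ charFlow T = M.coboundary c := by
  classical
  obtain ⟨c, hc⟩ := hT
  refine ⟨fun f => if f = f₀ then 0 else -c f, fun f => ?_, if_pos rfl, ?_⟩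
  · dsimp only
    split_ifs <;> simp
  · rw [hc, ← sum_smul_facialFlow, ← Finset.add_sum_erase _ _ (Finset.mem_univ f₀), if_pos rfl,
      zero_smul, zero_add]
    refine Finset.sum_congr (by congr) fun f hf => ?_
    rw [if_neg (Finset.ne_of_mem_erase hf)]

/-- Reversing a `0`-homologous subgraph of `D` stays in the homology class, and changes the
orientation if the subgraph is non-empty. -/
theorem exists_orientationDiff_eq {M : SurfaceMap V E F} {D₀ : EdgeOrientation E} {f₀ : F}
    (D : M.HomologyClass D₀ f₀) {T : Set (Dart E)} (hT : T ⊆ arcs D.1) (hne : T.Nonempty)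
    (h0 : M.ZeroHomologous T) :
    ∃ D' : M.HomologyClass D₀ f₀, D ≠ D' ∧ orientationDiff D.1 D'.1 = T := by
  have hdiff := orientationDiff_reverseOn hT
  have hmem : M.Homologous (charFlow (arcs (reverseOn D.1 T))) (charFlow (arcs D₀)) := by
    have h := two_smul_charFlow_orientationDiff D.1 (reverseOn D.1 T)
    rw [hdiff] at h
    rw [ZeroHomologous, Homologous, sub_zero] at h0
    have := sub_mem D.2 (nsmul_mem h0 2)
    rw [h] at this
    rwa [sub_sub_sub_cancel_left] at this
  refine ⟨⟨_, hmem⟩, ?_, hdiff⟩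
  intro h
  have h' : D.1 = reverseOn D.1 T := congrArg Subtype.val h
  rw [← h', orientationDiff, Set.sdiff_self] at hdiff
  exact hne.ne_empty hdiff.symm

/-! ### Potentials of the orientations in a homology class. -/

section Potential

variable [Fintype F] {M} {D₀ : EdgeOrientation E} {f₀ : F}

theorem exists_potential (D : M.HomologyClass D₀ f₀) : ∃ p : F → ℤ, p f₀ = 0 ∧
    charFlow (arcs D.1) - charFlow (arcs D₀) = 2 • M.coboundary p := by
  have h := D.2
  rw [Homologous, ← two_smul_charFlow_orientationDiff] at h
  obtain ⟨p, hp₀, hp⟩ :=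
    M.exists_coboundary_eq_of_mem f₀ (M.mem_facialSubgroup_of_two_smul f₀ h)
  exact ⟨p, hp₀, by rw [hp, two_smul_charFlow_orientationDiff]⟩

/-- The function on the faces, zero at `f₀`, whose coboundary is half the difference of the
characteristic flows of `D` and `D₀`. -/
noncomputable def potential (D : M.HomologyClass D₀ f₀) : F → ℤ := (exists_potential D).choose

theorem potential_base (D : M.HomologyClass D₀ f₀) : potential D f₀ = 0 :=
  (exists_potential D).choose_spec.1

theorem charFlow_arcs_eq (D : M.HomologyClass D₀ f₀) :
    charFlow (arcs D.1) = charFlow (arcs D₀) + 2 • M.coboundary (potential D) :=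
  eq_add_of_sub_eq' (exists_potential D).choose_spec.2

theorem potential_injective :
    Function.Injective (potential : M.HomologyClass D₀ f₀ → F → ℤ) := by
  intro D D' h
  apply Subtype.ext
  apply charFlow_arcs_injective
  simp only [charFlow_arcs_eq, h]

theorem charFlow_orientationDiff (D D' : M.HomologyClass D₀ f₀) :
    charFlow (orientationDiff D.1 D'.1) = M.coboundary (potential D - potential D') := by
  have h := two_smul_charFlow_orientationDiff D.1 D'.1
  rw [charFlow_arcs_eq D, charFlow_arcs_eq D', add_sub_add_left_eq_sub, ← smul_sub,
    ← map_sub] at h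
  exact smul_right_injective _ two_ne_zero h

theorem zeroHomologous_orientationDiff (D D' : M.HomologyClass D₀ f₀) :
    M.ZeroHomologous (orientationDiff D.1 D'.1) := by
  rw [ZeroHomologous, Homologous, sub_zero, charFlow_orientationDiff, facialSubgroup_eq_range]
  exact ⟨_, rfl⟩

/-- By uniqueness, the only normalised coefficients for `D ∖ D'` are `potential D - potential D'`;
hence the reversal. -/
theorem le_iff_potential_le {D D' : M.HomologyClass D₀ f₀} :
    D ≤ D' ↔ potential D' ≤ potential D := by
  constructor
  · rintro ⟨-, h⟩
    obtain ⟨c, hc, hc₀, h⟩ := M.isCounterclockwise_iff.1 h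
    rw [charFlow_orientationDiff] at h
    rw [← sub_nonneg, M.eq_of_coboundary_eq (f₀ := f₀) (by simp [potential_base, hc₀]) h]
    exact hc
  · intro h
    refine ⟨zeroHomologous_orientationDiff D D', M.isCounterclockwise_iff.2
      ⟨_, sub_nonneg.2 h, ?_, charFlow_orientationDiff D D'⟩⟩
    simp [potential_base]

theorem exists_potential_eq {p : F → ℤ} (hp₀ : p f₀ = 0)
    (hp : ∀ e, (charFlow (arcs D₀) + 2 • M.coboundary p) e = 1 ∨
      (charFlow (arcs D₀) + 2 • M.coboundary p) e = -1) :
    ∃ D : M.HomologyClass D₀ f₀, potential D = p := by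
  obtain ⟨D, hD⟩ := exists_charFlow_arcs_eq hp
  have hmem : M.Homologous (charFlow (arcs D)) (charFlow (arcs D₀)) := by
    rw [Homologous, hD, add_sub_cancel_left, facialSubgroup_eq_range]
    exact ⟨2 • p, map_nsmul _ _ _⟩
  let D' : M.HomologyClass D₀ f₀ := ⟨D, hmem⟩
  refine ⟨D', M.eq_of_coboundary_eq (f₀ := f₀) ((potential_base D').trans hp₀.symm) ?_⟩
  have h := hD.symm.trans (charFlow_arcs_eq D')
  exact (smul_right_injective _ two_ne_zero (add_left_cancel h)).symm

theorem charFlow_arcs_add_cases (D : M.HomologyClass D₀ f₀) (e : E) :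
    (charFlow (arcs D₀) + 2 • M.coboundary (potential D)) e = 1 ∨
      (charFlow (arcs D₀) + 2 • M.coboundary (potential D)) e = -1 := by
  rw [← charFlow_arcs_eq, charFlow_arcs_apply]
  split_ifs <;> simp

/-- At each edge the difference of a potential across it is limited to two consecutive integers,
that is, to an interval. Such difference bounds survive pointwise minima and maxima. -/
theorem exists_potential_eq_inf (D D' : M.HomologyClass D₀ f₀) :
    ∃ D'' : M.HomologyClass D₀ f₀, potential D'' = potential D ⊓ potential D' := by
  refine exists_potential_eq (by simp [potential_base]) fun e => ?_
  have h := charFlow_arcs_add_cases D e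
  have h' := charFlow_arcs_add_cases D' e
  simp only [two_nsmul, Pi.add_apply, coboundary_apply, Pi.inf_apply] at h h' ⊢
  omega

theorem exists_potential_eq_sup (D D' : M.HomologyClass D₀ f₀) :
    ∃ D'' : M.HomologyClass D₀ f₀, potential D'' = potential D ⊔ potential D' := by
  refine exists_potential_eq (by simp [potential_base]) fun e => ?_
  have h := charFlow_arcs_add_cases D e
  have h' := charFlow_arcs_add_cases D' e
  simp only [two_nsmul, Pi.add_apply, coboundary_apply, Pi.sup_apply] at h h' ⊢
  omega

/-! ### Extremal orientations. -/

theorem homologyClass_antisymm {D D' : M.HomologyClass D₀ f₀} (h : D ≤ D') (h' : D' ≤ D) :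
    D = D' :=
  potential_injective (le_antisymm (le_iff_potential_le.1 h') (le_iff_potential_le.1 h))

instance [Finite E] : Finite (M.HomologyClass D₀ f₀) :=
  inferInstanceAs (Finite {_D : EdgeOrientation E // _})

instance : Nonempty (M.HomologyClass D₀ f₀) :=
  ⟨⟨D₀, by rw [Homologous, sub_self]; exact zero_mem _⟩⟩

theorem existsUnique_isTop [Finite E] : ∃! D : M.HomologyClass D₀ f₀, IsTop D := by
  have hdir : Directed (· ≥ ·) (potential : M.HomologyClass D₀ f₀ → F → ℤ) := fun D D' => by
    obtain ⟨D'', h⟩ := exists_potential_eq_inf D D'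
    exact ⟨D'', h ▸ inf_le_left, h ▸ inf_le_right⟩
  -- The whole class is a finite family, so directedness bounds it by one of its own members.
  obtain ⟨D, hD⟩ := hdir.finite_le id
  have hD : IsTop D := fun D' => le_iff_potential_le.2 (hD D')
  exact ⟨D, hD, fun D' hD' => homologyClass_antisymm (hD D') (hD' D)⟩

theorem existsUnique_isBot [Finite E] : ∃! D : M.HomologyClass D₀ f₀, IsBot D := by
  have hdir : Directed (· ≤ ·) (potential : M.HomologyClass D₀ f₀ → F → ℤ) := fun D D' => by
    obtain ⟨D'', h⟩ := exists_potential_eq_sup D D'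
    exact ⟨D'', h ▸ le_sup_left, h ▸ le_sup_right⟩
  obtain ⟨D, hD⟩ := hdir.finite_le id
  have hD : IsBot D := fun D' => le_iff_potential_le.2 (hD D')
  exact ⟨D, hD, fun D' hD' => homologyClass_antisymm (hD' D) (hD D')⟩

theorem IsMax.not_isCounterclockwise {D : M.HomologyClass D₀ f₀} (hD : IsMax D)
    {T : Set (Dart E)} (hT : T ⊆ arcs D.1) (hne : T.Nonempty) (h0 : M.ZeroHomologous T) :
    ¬ M.IsCounterclockwise f₀ T := by
  intro hccw
  obtain ⟨D', hDD', rfl⟩ := exists_orientationDiff_eq D hT hne h0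
  have hle : D ≤ D' := ⟨h0, hccw⟩
  exact hDD' (homologyClass_antisymm hle (hD hle))

theorem IsMin.not_isClockwise {D : M.HomologyClass D₀ f₀} (hD : IsMin D)
    {T : Set (Dart E)} (hT : T ⊆ arcs D.1) (hne : T.Nonempty) (h0 : M.ZeroHomologous T) :
    ¬ M.IsClockwise f₀ T := by
  intro hcw
  obtain ⟨D', hDD', rfl⟩ := exists_orientationDiff_eq D hT hne h0
  obtain ⟨c, hc, hc₀, h⟩ := IsClockwise.exists_coboundary M hcw
  rw [charFlow_orientationDiff] at h
  -- The nonpositive coefficients of `T` must be `potential D - potential D'`.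
  have hle : D' ≤ D := by
    rw [le_iff_potential_le, ← sub_nonpos,
      M.eq_of_coboundary_eq (f₀ := f₀) (by simp [potential_base, hc₀]) h]
    exact hc
  exact hDD' (homologyClass_antisymm (hD hle) hle)

end Potential

end SurfaceMap

theorem proposition4p14 {V E F : Type*} [Fintype E] [Fintype F] (M : SurfaceMap V E F)
    (D₀ : EdgeOrientation E) (f₀ : F) :
    (∃! D : M.HomologyClass D₀ f₀, IsTop D) ∧
    (∃! D : M.HomologyClass D₀ f₀, IsBot D) ∧
    (∀ Dmax : M.HomologyClass D₀ f₀, IsMax Dmax →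
      ∀ T : Set (Dart E), T ⊆ arcs Dmax.1 → T.Nonempty → M.ZeroHomologous T →
        ¬ M.IsCounterclockwise f₀ T) ∧
    (∀ Dmin : M.HomologyClass D₀ f₀, IsMin Dmin →
      ∀ T : Set (Dart E), T ⊆ arcs Dmin.1 → T.Nonempty → M.ZeroHomologous T →
        ¬ M.IsClockwise f₀ T) :=
  ⟨SurfaceMap.existsUnique_isTop, SurfaceMap.existsUnique_isBot,
    fun _ hD _ hT hne h0 => SurfaceMap.IsMax.not_isCounterclockwise hD hT hne h0,
    fun _ hD _ hT hne h0 => SurfaceMap.IsMin.not_isClockwise hD hT hne h0⟩
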